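/- Attach to the fourteen parameters $\alpha_1,\dots,\alpha_{14}$ the four-digit representations $0123$, $0012$, $0102$, $0121$, $0122$, $0001$, $0010$, $0100$, $0111$, $0011$, $0101$, $0110$, $0112$, $0120$ (in this order), and let $K=\{\alpha_1,\dots,\alpha_{14}\}$. Let $\Sigma_n=\{0,\dots,n-1\}$. An instance over $\Sigma_n$ of the pattern $x\pi^i(x)\pi^j(x)\pi^k(x)$, where $i,j,k\ge 0$ are integers, is a word $u f^i(u) f^j(u) f^k(u)$, where $u$ is a nonempty word over $\Sigma_n$ and $f$ is a morphic permutation of $\Sigma_n$ (a permutation of $\Sigma_n$ extended letter by letter to words). The parameter $\alpha_a$ models this instance if any two of the four words $u, f^i(u), f^j(u), f^k(u)$ are equal if and only if the digits at the corresponding two positions in the representation of $\alpha_a$ are equal. Let $K'\subseteq K$ be a subset with at most $4$ elements. Then there exist a finite alphabet $\Sigma_m$ and an infinite word $w$ over $\Sigma_m$ such that $w$ contains no $4$-power (no factor $vvvv$ with $v$ a nonempty word) and, for all integers $i,j,k\ge 0$ and all $n\ge m$, no instance over $\Sigma_n$ of the pattern $x\pi^i(x)\pi^j(x)\pi^k(x)$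 that occurs as a factor of $w$ is modelled by an element of $K'$. -/

import Mathlib

/-- The finite word `v` occurs as a block of consecutive letters in the infinite word `w`. -/
def IsFactor {α : Type*} (v : List α) (w : ℕ → α) : Prop :=
  ∃ s : ℕ, v = (List.range v.length).map fun t => w (s + t)

/-- No factor of `w` has the form `vvvv` with `v` a nonempty word. -/
def FourPowerFree {α : Type*} (w : ℕ → α) : Prop :=
  ∀ v : List α, v ≠ [] → ¬ IsFactor (v ++ v ++ v ++ v) w

/-- The word `π ^ e (u)`, where `π` is the morphic permutation of the words over `α` that extends
the permutation `f` of the alphabet. -/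
def morphPow {α : Type*} (f : Equiv.Perm α) (e : ℕ) (u : List α) : List α :=
  (List.map f)^[e] u

/-- The four items `u`, `π ^ i (u)`, `π ^ j (u)`, `π ^ k (u)` of an instance of the pattern. -/
def items {α : Type*} (f : Equiv.Perm α) (i j k : ℕ) (u : List α) : Fin 4 → List α :=
  ![u, morphPow f i u, morphPow f j u, morphPow f k u]

/-- The word `u π ^ i (u) π ^ j (u) π ^ k (u)`. -/
def patternInstance {α : Type*} (f : Equiv.Perm α) (i j k : ℕ) (u : List α) : List α :=
  u ++ morphPow f i u ++ morphPow f j u ++ morphPow f k u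

/-- The fourteen parameters. -/
inductive Parameter
  | α₁ | α₂ | α₃ | α₄ | α₅ | α₆ | α₇ | α₈ | α₉ | α₁₀ | α₁₁ | α₁₂ | α₁₃ | α₁₄
  deriving DecidableEq

/-- The four-digit representation of each parameter. -/
def Parameter.digits : Parameter → Fin 4 → ℕ
  | α₁ => ![0, 1, 2, 3]
  | α₂ => ![0, 0, 1, 2]
  | α₃ => ![0, 1, 0, 2]
  | α₄ => ![0, 1, 2, 1]
  | α₅ => ![0, 1, 2, 2]
  | α₆ => ![0, 0, 0, 1]
  | α₇ => ![0, 0, 1, 0]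
  | α₈ => ![0, 1, 0, 0]
  | α₉ => ![0, 1, 1, 1]
  | α₁₀ => ![0, 0, 1, 1]
  | α₁₁ => ![0, 1, 0, 1]
  | α₁₂ => ![0, 1, 1, 0]
  | α₁₃ => ![0, 1, 1, 2]
  | α₁₄ => ![0, 1, 2, 0]

/-- The parameter `a` models the instance given by `u` and `f`: two of the four items are equal if
and only if the corresponding digits in the representation of `a` are equal. -/
def Parameter.Models {α : Type*} (a : Parameter) (f : Equiv.Perm α) (i j k : ℕ) (u : List α) :
    Prop :=
  ∀ p q : Fin 4, items f i j k u p = items f i j k u q ↔ a.digits p = a.digits q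

/-- The infinite word `w` over the alphabet with `m` letters, read over any finite alphabet that
contains these letters, has no instance (with a nonempty word and a morphic permutation
of that larger alphabet) of a pattern `x π ^ i (x) π ^ j (x) π ^ k (x)` that is modelled by an
element of `S`, whatever the exponents. -/
def AvoidsParameters {m : ℕ} (w : ℕ → Fin m) (S : Finset Parameter) : Prop :=
  ∀ (i j k n : ℕ) (hmn : m ≤ n) (f : Equiv.Perm (Fin n)) (u : List (Fin n)), u ≠ [] →
    IsFactor (patternInstance f i j k u) (fun t => Fin.castLE hmn (w t)) →
      ∀ a ∈ S, ¬ a.Models f i j k u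

/-!
Every word used here is the image of the Thue–Morse sequence under a substitution that replaces the
two letters by two different blocks of the same length `M`. Which parameters model an instance in
such an image can be read off from boundedly many short factors, for the following reasons.

* The items of an instance are images of one word under permutations of the letters, so they have
  the same shape (`SameShape`). If any two factors of length `L` of the same shape are equal
  (`Coding.Rigid`), then the items of an instance with `|u| ≥ L` are all equal, and no parameter
  models it.
* If some factor occurs exactly at the positions in one residue class modulo `M`
  (`Coding.Synchronizing`), then a fourth power `vvvv` with `|v| ≥ L` has `M ∣ |v|`. It
  contains at least `4 |v| / M - 1` whole blocks, and so comes from a cube in the Thue–Morse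
  sequence, which has none (`thueMorse_cubeFree`).
* The instances with `|u| < L` lie in the image of four consecutive letters of the Thue–Morse
  sequence, for which there are ten possibilities. They are inspected one by one
  (`Coding.ShortModelled`); a short fourth power is excluded by the same inspection, because
  every parameter has two different digits.

So a valid coding yields a word free of fourth powers whose instances are modelled only by the
parameters in a known list. It remains to exhibit a family of codings such that every set of at
most four parameters is disjoint from one of the lists. One coding has the list `[α₁]`, so only
sets that contain `α₁` matter; for those, eleven codings whose lists omit `α₁` suffice for the other
three elements (`Coding.exists_mem_family_of_three`).
-/

/-! ### The Thue–Morse sequence -/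

/-- The Thue–Morse sequence: the parity of the number of ones in the binary digits of `n`. -/
def thueMorse : ℕ → Bool
  | 0 => false
  | n + 1 => xor ((n + 1) % 2 == 1) (thueMorse ((n + 1) / 2))
decreasing_by omega

theorem thueMorse_two_mul (n : ℕ) : thueMorse (2 * n) = thueMorse n := by
  rcases n with _ | n
  · rfl
  · rw [show 2 * (n + 1) = (2 * n + 1) + 1 by ring, thueMorse]
    have h1 : (2 * n + 1 + 1) % 2 = 0 := by omega
    have h2 : (2 * n + 1 + 1) / 2 = n + 1 := by omega
    simp [h1, h2]

theorem thueMorse_two_mul_add_one (n : ℕ) : thueMorse (2 * n + 1) = !thueMorse n := by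
  rw [thueMorse]
  have h1 : (2 * n + 1) % 2 = 1 := by omega
  have h2 : (2 * n + 1) / 2 = n := by omega
  simp [h1, h2]

theorem thueMorse_ne_succ_of_even {n : ℕ} (hn : n % 2 = 0) : thueMorse n ≠ thueMorse (n + 1) := by
  obtain ⟨k, rfl⟩ : ∃ k, n = 2 * k := ⟨n / 2, by omega⟩
  rw [thueMorse_two_mul, thueMorse_two_mul_add_one]
  simp

theorem thueMorse_not_const (n : ℕ) :
    ¬ (thueMorse n = thueMorse (n + 1) ∧ thueMorse (n + 1) = thueMorse (n + 2)) := by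
  rintro ⟨h1, h2⟩
  rcases Nat.mod_two_eq_zero_or_one n with h | h
  · exact thueMorse_ne_succ_of_even h h1
  · exact thueMorse_ne_succ_of_even (n := n + 1) (by omega) h2

/-- The Thue–Morse sequence has no cube: an even period can be halved, and an odd period forces
five alternating letters. -/
theorem thueMorse_cubeFree (p : ℕ) (hp : 0 < p) (s : ℕ) :
    ¬ ∀ i < 2 * p, thueMorse (s + i) = thueMorse (s + i + p) := by
  induction p using Nat.strong_induction_on generalizing s with
  | _ p ih =>
    intro h
    rcases Nat.mod_two_eq_zero_or_one p with hpar | hpar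
    · obtain ⟨r, rfl⟩ : ∃ r, p = 2 * r := ⟨p / 2, by omega⟩
      refine ih r (by omega) (by omega) ((s + 1) / 2) fun i hi => ?_
      have := h (2 * ((s + 1) / 2 + i) - s) (by omega)
      rw [show s + (2 * ((s + 1) / 2 + i) - s) = 2 * ((s + 1) / 2 + i) by omega,
        ← mul_add, thueMorse_two_mul, thueMorse_two_mul] at this
      exact this
    · rcases Nat.lt_or_ge p 3 with hp3 | hp3
      · obtain rfl : p = 1 := by omega
        exact thueMorse_not_const s ⟨h 0 (by omega), h 1 (by omega)⟩
      · -- an odd period moves an odd position to an even one, so neighbours differ everywhere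
        have alt : ∀ i < 4, thueMorse (s + i) ≠ thueMorse (s + i + 1) := by
          intro i hi
          rcases Nat.mod_two_eq_zero_or_one (s + i) with h0 | h0
          · exact thueMorse_ne_succ_of_even h0
          · have h1 := h i (by omega)
            have h2 := h (i + 1) (by omega)
            have h3 := thueMorse_ne_succ_of_even (n := s + i + p) (by omega)
            rw [h1, show s + i + 1 = s + (i + 1) by ring, h2]
            convert h3 using 2
            ring
        have step : ∀ i < 3, thueMorse (s + i) = thueMorse (s + i + 2) := by
          intro i hi
          have h1 := alt i (by omega)
          have h2 := alt (i + 1) (by omega)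
          rw [show s + (i + 1) = s + i + 1 by ring, show s + i + 1 + 1 = s + i + 2 by ring] at h2
          revert h1 h2
          generalize thueMorse (s + i) = a
          generalize thueMorse (s + i + 1) = b
          generalize thueMorse (s + i + 2) = c
          revert a b c
          decide
        have h0 := step 0 (by omega)
        have h2 := step 2 (by omega)
        rcases Nat.mod_two_eq_zero_or_one s with hs | hs
        · obtain ⟨k, rfl⟩ : ∃ k, s = 2 * k := ⟨s / 2, by omega⟩
          refine thueMorse_not_const k ⟨?_, ?_⟩
          · simpa only [add_zero, ← mul_add_one, thueMorse_two_mul] using h0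
          · rw [show 2 * k + 2 + 2 = 2 * (k + 2) by ring, show 2 * k + 2 = 2 * (k + 1) by ring,
              thueMorse_two_mul, thueMorse_two_mul] at h2
            exact h2
        · obtain ⟨k, rfl⟩ : ∃ k, s = 2 * k + 1 := ⟨s / 2, by omega⟩
          refine thueMorse_not_const k ⟨?_, ?_⟩
          · rw [show 2 * k + 1 + 0 + 2 = 2 * (k + 1) + 1 by ring, add_zero,
              thueMorse_two_mul_add_one, thueMorse_two_mul_add_one] at h0
            simpa using h0
          · rw [show 2 * k + 1 + 2 + 2 = 2 * (k + 2) + 1 by ring,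
              show 2 * k + 1 + 2 = 2 * (k + 1) + 1 by ring,
              thueMorse_two_mul_add_one, thueMorse_two_mul_add_one] at h2
            simpa using h2

/-! ### Comparing factors of infinite words -/

/-- Whether `p` holds for all numbers below `n`; recursion on `n` keeps kernel evaluation short. -/
def allBelow (n : ℕ) (p : ℕ → Bool) : Bool := Nat.rec true (fun k b => p k && b) n

theorem allBelow_iff {n : ℕ} {p : ℕ → Bool} : allBelow n p = true ↔ ∀ i < n, p i = true := by
  induction n with
  | zero => simp [allBelow]
  | succ n ih =>
    rw [Nat.forall_lt_succ_right, ← ih, and_comm, ← Bool.and_eq_true]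
    rfl

/-- The words `x` and `y` have the same first `l` letters. -/
def SameFactor (x y : ℕ → ℕ) (l : ℕ) : Prop := ∀ i < l, x i = y i

/-- The prefixes of length `l` of `x` and `y` have equal letters at the same pairs of positions,
that is, each is the image of the other under an injective renaming of letters. -/
def SameShape (x y : ℕ → ℕ) (l : ℕ) : Prop :=
  ∀ i < l, ∀ j < i, (x i = x j ↔ y i = y j)

instance (x y : ℕ → ℕ) (l : ℕ) : Decidable (SameFactor x y l) :=
  decidable_of_iff (allBelow l (fun i => Nat.beq (x i) (y i)) = true) (by
    simp only [allBelow_iff, Nat.beq_eq]; rfl)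

instance (x y : ℕ → ℕ) (l : ℕ) : Decidable (SameShape x y l) :=
  decidable_of_iff (allBelow l (fun i => allBelow i fun j =>
    cond (Nat.beq (x i) (x j)) (Nat.beq (y i) (y j)) (!Nat.beq (y i) (y j))) = true) (by
    simp only [allBelow_iff, SameShape]
    refine forall₄_congr fun i _ j _ => ?_
    by_cases hx : x i = x j <;> by_cases hy : y i = y j <;>
      simp [hx, hy, Bool.eq_false_iff])

theorem SameFactor.congr {x x' y y' : ℕ → ℕ} {l : ℕ} (hx : SameFactor x x' l)
    (hy : SameFactor y y' l) : SameFactor x y l ↔ SameFactor x' y' l :=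
  forall₂_congr fun i hi => by rw [hx i hi, hy i hi]

theorem SameShape.congr {x x' y y' : ℕ → ℕ} {l : ℕ} (hx : SameFactor x x' l)
    (hy : SameFactor y y' l) : SameShape x y l ↔ SameShape x' y' l :=
  forall₄_congr fun i hi j hj => by
    rw [hx i hi, hx j (hj.trans hi), hy i hi, hy j (hj.trans hi)]

theorem SameFactor.sameShape {x y : ℕ → ℕ} {l : ℕ} (h : SameFactor x y l) : SameShape x y l :=
  fun i hi j hj => by rw [h i hi, h j (hj.trans hi)]

/-- The infinite word `x` without its first `n` letters. -/
def shift (n : ℕ) (x : ℕ → ℕ) (i : ℕ) : ℕ := x (n + i)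

theorem shift_shift (m n : ℕ) (x : ℕ → ℕ) : shift m (shift n x) = shift (n + m) x := by
  funext i
  simp [shift, add_assoc]

theorem SameFactor.shift {x y : ℕ → ℕ} {l k l' : ℕ} (h : SameFactor x y l) (hk : k + l' ≤ l) :
    SameFactor (shift k x) (shift k y) l' :=
  fun i hi => h (k + i) (by omega)

theorem SameShape.shift {x y : ℕ → ℕ} {l k l' : ℕ} (h : SameShape x y l) (hk : k + l' ≤ l) :
    SameShape (shift k x) (shift k y) l' :=
  fun i hi j hj => h (k + i) (by omega) (k + j) (by omega)

/-- The first four blocks of length `l` of `x` are equal exactly where the digits of `a` are. -/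
def Parameter.Fits (a : Parameter) (x : ℕ → ℕ) (l : ℕ) : Prop :=
  ∀ p q : Fin 4, SameFactor (shift (p * l) x) (shift (q * l) x) l ↔ a.digits p = a.digits q

instance (a : Parameter) (x : ℕ → ℕ) (l : ℕ) : Decidable (a.Fits x l) := by
  unfold Parameter.Fits; infer_instance

theorem Parameter.Fits.unique {a b : Parameter} {x : ℕ → ℕ} {l : ℕ} (ha : a.Fits x l)
    (hb : b.Fits x l) : a = b := by
  have h : ∀ p q, a.digits p = a.digits q ↔ b.digits p = b.digits q := fun p q =>
    (ha p q).symm.trans (hb p q)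
  have h01 := h 0 1
  have h02 := h 0 2
  have h03 := h 0 3
  have h12 := h 1 2
  have h13 := h 1 3
  have h23 := h 2 3
  clear h ha hb
  revert h01 h02 h03 h12 h13 h23
  cases a <;> cases b <;> decide

theorem Parameter.exists_digits_ne (a : Parameter) : ∃ p q, a.digits p ≠ a.digits q := by
  cases a <;> decide

theorem Parameter.Fits.congr {a : Parameter} {x x' : ℕ → ℕ} {l : ℕ} (hx : SameFactor x x' (4 * l)) :
    a.Fits x l ↔ a.Fits x' l := by
  refine forall₂_congr fun p q => ?_
  have h : ∀ p : Fin 4, p * l + l ≤ 4 * l := fun p => by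
    rw [← add_one_mul]; exact Nat.mul_le_mul_right l p.isLt
  rw [SameFactor.congr (hx.shift (h p)) (hx.shift (h q))]

/-! ### Substituted words -/

/-- A pair of blocks to be substituted for the two letters of an infinite binary word, with the
data that control the pattern instances in the result. The blocks `zero` and `one` are words of
length `size` over the ten digits, written as decimal numbers. The factor of length `markerLength`
at `offset` is meant to occur exactly at the positions congruent to `offset` modulo `size`, factors
of length `bound` of the same shape are meant to be equal, and `types` are the parameters that may
model instances with items shorter than `bound`. -/
structure Coding where
  size : ℕ
  zero : ℕ
  one : ℕ
  offset : ℕ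
  markerLength : ℕ
  bound : ℕ
  types : List Parameter

namespace Coding

/-- The infinite word in which each letter of the binary word `t` is replaced by its block. -/
def word (c : Coding) (t : ℕ → Bool) (n : ℕ) : ℕ :=
  (bif t (n / c.size) then c.one else c.zero) / 10 ^ (c.size - 1 - n % c.size) % 10

/-- The image of the finite binary word `b`, without its first `n` letters; letters past the end
of the image are junk. -/
def view (c : Coding) (b : List Bool) (n : ℕ) : ℕ → ℕ :=
  shift n (c.word fun k => b.getD k false)

/-- The binary words of length `4` without a cube of a letter. -/
def contexts : List (List Bool) :=
  [[false, false, true, false], [false, false, true, true], [false, true, false, false],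
    [false, true, false, true], [false, true, true, false], [true, false, false, true],
    [true, false, true, false], [true, false, true, true], [true, true, false, false],
    [true, true, false, true]]

/-- The binary words of length `2`. -/
def pairs : List (List Bool) := [[false, false], [false, true], [true, false], [true, true]]

/-- If the first four blocks of length `l` of `x` have the same shape, then an element of
`c.types` models them. -/
def BlocksModelled (c : Coding) (x : ℕ → ℕ) (l : ℕ) : Prop :=
  SameShape x (shift l x) l → SameShape x (shift (2 * l) x) l → SameShape x (shift (3 * l) x) l →
    ∃ a ∈ c.types, a.Fits x l

instance (c : Coding) (x : ℕ → ℕ) (l : ℕ) : Decidable (c.BlocksModelled x l) := by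
  unfold BlocksModelled; infer_instance

theorem BlocksModelled.congr {c : Coding} {x x' : ℕ → ℕ} {l : ℕ} (hx : SameFactor x x' (4 * l)) :
    c.BlocksModelled x l ↔ c.BlocksModelled x' l := by
  have h0 : SameFactor x x' l := fun i hi => hx i (by omega)
  simp only [BlocksModelled, Parameter.Fits.congr hx,
    SameShape.congr h0 (hx.shift (k := l) (l' := l) (by omega)),
    SameShape.congr h0 (hx.shift (k := 2 * l) (l' := l) (by omega)),
    SameShape.congr h0 (hx.shift (k := 3 * l) (l' := l) (by omega))]

/-- Relations between the lengths: four items shorter than `bound` fit into the image of four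
letters from any position in the image of the first, and a stretch of length `3 * bound` contains
the marker. -/
def Sizes (c : Coding) : Prop :=
  0 < c.size ∧ c.offset < c.size ∧ 0 < c.bound ∧ 4 * c.bound ≤ 3 * c.size + 5 ∧
    c.markerLength ≤ 3 * c.size ∧ c.size + c.markerLength ≤ 3 * c.bound + 1

/-- The two blocks differ. -/
def BlocksDiffer (c : Coding) : Prop :=
  ¬ SameFactor (c.view [false] 0) (c.view [true] 0) c.size

/-- The marker, read off in the image of a constant word, occurs exactly at the positions congruent
to `offset` modulo `size`. -/
def Synchronizing (c : Coding) : Prop :=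
  ∀ b ∈ contexts, ∀ r < c.size,
    (SameFactor (c.view b r) (c.view [] c.offset) c.markerLength ↔ r = c.offset)

/-- Factors of length `bound` with the same shape are equal. -/
def Rigid (c : Coding) : Prop :=
  ∀ b ∈ pairs, ∀ b' ∈ pairs, ∀ r < c.size, ∀ s < c.size,
    SameShape (c.view b r) (c.view b' s) c.bound → SameFactor (c.view b r) (c.view b' s) c.bound

/-- Instances with items shorter than `bound` are modelled by an element of `types`. -/
def ShortModelled (c : Coding) : Prop :=
  ∀ b ∈ contexts, ∀ r < c.size, ∀ l < c.bound, 0 < l → c.BlocksModelled (c.view b r) l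

/-- The finite conditions under which the image of the Thue–Morse sequence is free of fourth powers
and contains no instances other than those modelled by an element of `types`. -/
def Valid (c : Coding) : Prop :=
  c.Sizes ∧ c.BlocksDiffer ∧ c.Synchronizing ∧ c.Rigid ∧ c.ShortModelled

instance (c : Coding) : Decidable c.Sizes := by unfold Sizes; infer_instance

instance (c : Coding) : Decidable c.BlocksDiffer := by unfold BlocksDiffer; infer_instance

instance (c : Coding) : Decidable c.Synchronizing := by unfold Synchronizing; infer_instance

instance (c : Coding) : Decidable c.Rigid := by unfold Rigid; infer_instance

instance (c : Coding) : Decidable c.ShortModelled := by unfold ShortModelled; infer_instance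

instance (c : Coding) : Decidable c.Valid := by unfold Valid; infer_instance

/-- From any position, the image of `t` looks like the image of the letters of `t` from there on. -/
theorem sameFactor_view {c : Coding} (hc : 0 < c.size) {t : ℕ → Bool} {b : List Bool} {n l : ℕ}
    (hl : n % c.size + l ≤ b.length * c.size)
    (hb : ∀ j < b.length, t (n / c.size + j) = b.getD j false) :
    SameFactor (shift n (c.word t)) (c.view b (n % c.size)) l := by
  intro i hi
  have h1 : n + i = c.size * (n / c.size) + (n % c.size + i) := by
    rw [← add_assoc, Nat.div_add_mod]
  have h2 : (n + i) / c.size = n / c.size + (n % c.size + i) / c.size := by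
    rw [h1, Nat.mul_add_div hc]
  have h3 : (n + i) % c.size = (n % c.size + i) % c.size := by
    rw [h1, Nat.mul_add_mod]
  have h4 : (n % c.size + i) / c.size < b.length := by
    rw [Nat.div_lt_iff_lt_mul hc]; omega
  simp only [view, shift, word, h2, h3, hb _ h4]

theorem word_lt (c : Coding) (t : ℕ → Bool) (n : ℕ) : c.word t n < 10 :=
  Nat.mod_lt _ (by norm_num)

theorem thueMorse_mem_contexts (k : ℕ) :
    [thueMorse k, thueMorse (k + 1), thueMorse (k + 2), thueMorse (k + 3)] ∈ contexts := by
  have h1 := thueMorse_not_const k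
  have h2 := thueMorse_not_const (k + 1)
  revert h1 h2
  rw [show k + 1 + 1 = k + 2 by ring, show k + 1 + 2 = k + 3 by ring]
  generalize thueMorse k = x
  generalize thueMorse (k + 1) = y
  generalize thueMorse (k + 2) = z
  generalize thueMorse (k + 3) = u
  revert x y z u
  decide

/-- Every position of the image of the Thue–Morse sequence has one of the ten contexts. -/
theorem exists_context {c : Coding} (hc : 0 < c.size) (n : ℕ) :
    ∃ b ∈ contexts, ∀ l, n % c.size + l ≤ 4 * c.size →
      SameFactor (shift n (c.word thueMorse)) (c.view b (n % c.size)) l := by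
  refine ⟨_, thueMorse_mem_contexts (n / c.size), fun l hl => sameFactor_view hc hl fun j hj => ?_⟩
  have : j < 4 := hj
  interval_cases j <;> rfl

theorem exists_pair {c : Coding} (hc : 0 < c.size) (t : ℕ → Bool) (n : ℕ) :
    ∃ b ∈ pairs, ∀ l, n % c.size + l ≤ 2 * c.size →
      SameFactor (shift n (c.word t)) (c.view b (n % c.size)) l := by
  refine ⟨[t (n / c.size), t (n / c.size + 1)], ?_, fun l hl => sameFactor_view hc hl fun j hj => ?_⟩
  · generalize t (n / c.size) = x
    generalize t (n / c.size + 1) = y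
    revert x y
    decide
  · have : j < 2 := hj
    interval_cases j <;> rfl

namespace Valid

variable {c : Coding}

theorem size_pos (h : c.Valid) : 0 < c.size := h.1.1

theorem marker_iff (h : c.Valid) (n : ℕ) :
    SameFactor (shift n (c.word thueMorse)) (c.view [] c.offset) c.markerLength ↔
      n % c.size = c.offset := by
  obtain ⟨⟨hc, -, -, -, hm, -⟩, -, hsync, -, -⟩ := h
  obtain ⟨b, hb, hv⟩ := exists_context hc n
  have hr := Nat.mod_lt n hc
  rw [SameFactor.congr (hv _ (by omega)) fun _ _ => rfl]
  exact hsync b hb _ hr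

theorem blocksModelled (h : c.Valid) (n : ℕ) {l : ℕ} (hl : 0 < l) (hl' : l < c.bound) :
    c.BlocksModelled (shift n (c.word thueMorse)) l := by
  obtain ⟨⟨hc, -, -, hb4, -, -⟩, -, -, -, hshort⟩ := h
  obtain ⟨b, hb, hv⟩ := exists_context hc n
  have hr := Nat.mod_lt n hc
  rw [BlocksModelled.congr (hv _ (by omega))]
  exact hshort b hb _ hr l hl' hl

theorem sameFactor_of_sameShape (h : c.Valid) (t : ℕ → Bool) {n n' l : ℕ} (hl : c.bound ≤ l)
    (hs : SameShape (shift n (c.word t)) (shift n' (c.word t)) l) :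
    SameFactor (shift n (c.word t)) (shift n' (c.word t)) l := by
  obtain ⟨⟨hc, -, hpos, hb4, hm, hb3⟩, -, -, hrigid, -⟩ := h
  have key : ∀ m m', SameShape (shift m (c.word t)) (shift m' (c.word t)) c.bound →
      SameFactor (shift m (c.word t)) (shift m' (c.word t)) c.bound := by
    intro m m' hs
    obtain ⟨b, hb, hv⟩ := exists_pair hc t m
    obtain ⟨b', hb', hv'⟩ := exists_pair hc t m'
    have hr := Nat.mod_lt m hc
    have hr' := Nat.mod_lt m' hc
    rw [SameShape.congr (hv _ (by omega)) (hv' _ (by omega))] at hs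
    rw [SameFactor.congr (hv _ (by omega)) (hv' _ (by omega))]
    exact hrigid b hb b' hb' _ hr _ hr' hs
  intro i hi
  -- the window of length `bound` that starts at `i`, or ends at the end of the factor
  have h2 := key (n + min i (l - c.bound)) (n' + min i (l - c.bound)) (by
    rw [← shift_shift, ← shift_shift]
    exact hs.shift (by omega)) (i - min i (l - c.bound)) (by omega)
  simp only [Coding.word, _root_.shift] at h2 ⊢
  rwa [show n + min i (l - c.bound) + (i - min i (l - c.bound)) = n + i by omega,
    show n' + min i (l - c.bound) + (i - min i (l - c.bound)) = n' + i by omega] at h2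

theorem eq_of_sameFactor (h : c.Valid) {t : ℕ → Bool} {k k' : ℕ}
    (he : SameFactor (shift (k * c.size) (c.word t)) (shift (k' * c.size) (c.word t)) c.size) :
    t k = t k' := by
  have hv : ∀ m, SameFactor (shift (m * c.size) (c.word t)) (c.view [t m] 0) c.size := by
    intro m
    have := sameFactor_view (t := t) (b := [t m]) (n := m * c.size) (l := c.size) h.size_pos
      (by simp) (by simp [Nat.mul_div_cancel _ h.size_pos])
    simpa using this
  rw [SameFactor.congr (hv k) (hv k')] at he
  have hd := h.2.1
  revert he
  generalize t k = x
  generalize t k' = y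
  rcases x <;> rcases y <;> simp only [imp_true_iff, reduceCtorEq, imp_false]
  · exact hd
  · exact fun he => hd fun i hi => (he i hi).symm

/-- A fourth power of a long word would force its period to be a multiple of the block length, and
so a cube in the Thue–Morse sequence. -/
theorem not_sameFactor_of_bound_le (h : c.Valid) (s : ℕ) {p : ℕ} (hp : c.bound ≤ p) (hp0 : 0 < p) :
    ¬ SameFactor (shift s (c.word thueMorse)) (shift (s + p) (c.word thueMorse)) (3 * p) := by
  intro he
  have hc := h.size_pos
  obtain ⟨hoff, -, -, -, hb3⟩ := h.1.2
  -- the marker occurs within one block length from `s`, hence also `p` letters later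
  obtain ⟨j, hj, hjo⟩ : ∃ j < c.size, (s + j) % c.size = c.offset := by
    refine ⟨(c.offset + (c.size - s % c.size)) % c.size, Nat.mod_lt _ hc, ?_⟩
    have hs := Nat.mod_lt s hc
    rw [Nat.add_mod_mod, ← Nat.mod_add_mod,
      show s % c.size + (c.offset + (c.size - s % c.size)) = c.offset + c.size by omega,
      Nat.add_mod_right, Nat.mod_eq_of_lt hoff]
  have hmark := (h.marker_iff (s + j)).2 hjo
  have htrans := he.shift (k := j) (l' := c.markerLength) (by omega)
  rw [shift_shift, shift_shift] at htrans
  rw [SameFactor.congr htrans fun _ _ => rfl, h.marker_iff] at hmark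
  have hdvd : c.size ∣ p := by
    have : (s + j) ≡ (s + j) + p [MOD c.size] := by
      rw [Nat.ModEq, hjo, ← hmark]
      congr 1
      ring
    simpa using (Nat.modEq_iff_dvd' (by omega)).1 this
  obtain ⟨q, rfl⟩ := hdvd
  have hq : 0 < q := Nat.pos_of_mul_pos_left hp0
  -- the first block boundary after `s`
  obtain ⟨k, hk1, hk2⟩ : ∃ k, s ≤ k * c.size ∧ k * c.size + 1 ≤ s + c.size := by
    refine ⟨(s + c.size - 1) / c.size, ?_, ?_⟩
    · have := Nat.lt_div_mul_add (a := s + c.size - 1) hc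
      omega
    · have := Nat.div_mul_le_self (s + c.size - 1) c.size
      omega
  refine thueMorse_cubeFree q hq k fun i hi => h.eq_of_sameFactor ?_
  have hle : (i + 2) * c.size ≤ 3 * (c.size * q) := by
    calc (i + 2) * c.size ≤ (3 * q) * c.size := Nat.mul_le_mul_right _ (by omega)
      _ = 3 * (c.size * q) := by ring
  have hb := he.shift (k := (k + i) * c.size - s) (l' := c.size) (by
    have : (i + 2) * c.size = i * c.size + 2 * c.size := by ring
    have : (k + i) * c.size = k * c.size + i * c.size := by ring
    omega)
  rw [shift_shift, shift_shift] at hb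
  have hki : s ≤ (k + i) * c.size := hk1.trans (Nat.mul_le_mul_right _ (by omega))
  rw [show s + ((k + i) * c.size - s) = (k + i) * c.size by omega,
    show s + c.size * q + ((k + i) * c.size - s) = (k + i) * c.size + c.size * q by omega,
    show (k + i) * c.size + c.size * q = (k + i + q) * c.size by ring] at hb
  exact hb

/-- Four consecutive items of the same shape are never all equal, and a parameter that models them
belongs to `types`. -/
theorem mem_types (h : c.Valid) {s l : ℕ} (hl : 0 < l)
    (hs : ∀ p < 4, SameShape (shift s (c.word thueMorse)) (shift (s + p * l) (c.word thueMorse)) l)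
    {a : Parameter} (ha : a.Fits (shift s (c.word thueMorse)) l) : a ∈ c.types := by
  rcases lt_or_ge l c.bound with hlb | hlb
  · obtain ⟨b, hb, hbf⟩ := h.blocksModelled s hl hlb
      (by simpa [shift_shift] using hs 1 (by norm_num))
      (by simpa [shift_shift] using hs 2 (by norm_num))
      (by simpa [shift_shift] using hs 3 (by norm_num))
    rwa [ha.unique hbf]
  · obtain ⟨p, q, hpq⟩ := a.exists_digits_ne
    refine absurd ((ha p q).1 fun i hi => ?_) hpq
    rw [shift_shift, shift_shift]
    exact (h.sameFactor_of_sameShape _ hlb (hs p p.isLt) i hi).symm.trans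
      (h.sameFactor_of_sameShape _ hlb (hs q q.isLt) i hi)

theorem not_fourPower (h : c.Valid) {s l : ℕ} (hl : 0 < l) :
    ¬ ∀ p < 4, SameFactor (shift s (c.word thueMorse)) (shift (s + p * l) (c.word thueMorse)) l := by
  intro hs
  rcases lt_or_ge l c.bound with hlb | hlb
  · obtain ⟨b, -, hbf⟩ := h.blocksModelled s hl hlb
      (by simpa [shift_shift] using (hs 1 (by norm_num)).sameShape)
      (by simpa [shift_shift] using (hs 2 (by norm_num)).sameShape)
      (by simpa [shift_shift] using (hs 3 (by norm_num)).sameShape)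
    obtain ⟨p, q, hpq⟩ := b.exists_digits_ne
    refine hpq ((hbf p q).1 fun i hi => ?_)
    rw [shift_shift, shift_shift]
    exact (hs p p.isLt i hi).symm.trans (hs q q.isLt i hi)
  · refine h.not_sameFactor_of_bound_le s hlb hl fun i hi => ?_
    have hd : i / l < 3 := (Nat.div_lt_iff_lt_mul hl).2 hi
    have hm := Nat.mod_lt i hl
    have h1 := hs (i / l) (by omega) (i % l) hm
    have h2 := hs (i / l + 1) (by omega) (i % l) hm
    have hi' : i / l * l + i % l = i := Nat.div_add_mod' i l
    simp only [shift] at h1 h2 ⊢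
    rw [show s + i = s + i / l * l + i % l by omega, ← h1, h2]
    congr 1
    rw [add_one_mul]
    omega

end Valid

end Coding

/-! ### From instances to factors -/

theorem morphPow_eq_map {α : Type*} (f : Equiv.Perm α) (e : ℕ) (u : List α) :
    morphPow f e u = u.map f^[e] := by
  induction e generalizing u with
  | zero => simp [morphPow]
  | succ e ih =>
    rw [morphPow, Function.iterate_succ_apply, ← morphPow, ih, List.map_map,
      Function.iterate_succ]

/-- The items of an instance are the images of the first item under injective maps of letters. -/
theorem exists_items_eq_map {α : Type*} (f : Equiv.Perm α) (i j k : ℕ) (u : List α) (p : Fin 4) :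
    ∃ g : α → α, Function.Injective g ∧ items f i j k u p = u.map g := by
  have h : ∀ e, Function.Injective f^[e] := fun e => f.injective.iterate e
  fin_cases p
  · exact ⟨id, Function.injective_id, by simp [items]⟩
  · exact ⟨f^[i], h i, by simp [items, morphPow_eq_map]⟩
  · exact ⟨f^[j], h j, by simp [items, morphPow_eq_map]⟩
  · exact ⟨f^[k], h k, by simp [items, morphPow_eq_map]⟩

/-- Four words of equal length whose product is a factor are consecutive factors. -/
theorem IsFactor.exists_blocks {α : Type*} {w : ℕ → α} {x : Fin 4 → List α} {l : ℕ}
    (hx : ∀ p, (x p).length = l) (h : IsFactor (x 0 ++ x 1 ++ x 2 ++ x 3) w) :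
    ∃ s, ∀ p : Fin 4, x p = (List.range l).map fun i => w (s + p * l + i) := by
  obtain ⟨s, hs⟩ := h
  refine ⟨s, ?_⟩
  simp only [List.length_append, hx, List.range_add, List.map_append, List.map_map] at hs
  obtain ⟨hs, h3⟩ := List.append_inj' hs (by simp [hx])
  obtain ⟨hs, h2⟩ := List.append_inj' hs (by simp [hx])
  obtain ⟨h0, h1⟩ := List.append_inj' hs (by simp [hx])
  intro p
  fin_cases p
  · simpa using h0
  · simpa [Function.comp_def, add_assoc] using h1
  · simpa [Function.comp_def, add_assoc, two_mul] using h2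
  · rw [show ((⟨3, by norm_num⟩ : Fin 4) : ℕ) * l = l + l + l by simp; ring]
    simpa [Function.comp_def, add_assoc] using h3

namespace Coding

/-- The image of the Thue–Morse sequence, as a word over the ten digits. -/
def finWord (c : Coding) (n : ℕ) : Fin 10 := ⟨c.word thueMorse n, c.word_lt _ n⟩

theorem Valid.fourPowerFree {c : Coding} (h : c.Valid) : FourPowerFree c.finWord := by
  intro v hv hf
  obtain ⟨s, hs⟩ := IsFactor.exists_blocks (x := fun _ => v) (fun _ => rfl) hf
  refine h.not_fourPower (s := s) (List.length_pos_of_ne_nil hv) fun p hp i hi => ?_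
  have h0 := (hs 0).symm.trans (hs ⟨p, hp⟩)
  have := List.map_inj_left.1 h0 i (List.mem_range.2 hi)
  simpa [finWord, shift] using this

theorem Valid.avoidsParameters {c : Coding} (h : c.Valid) {S : Finset Parameter}
    (hS : ∀ a ∈ c.types, a ∉ S) : AvoidsParameters c.finWord S := by
  intro i j k n hmn f u hu hf a ha hmod
  choose g hg hitems using exists_items_eq_map f i j k u
  obtain ⟨s, hs⟩ := IsFactor.exists_blocks (x := items f i j k u) (l := u.length)
    (fun p => by simp [hitems]) hf
  have hu0 : u = (List.range u.length).map fun t => Fin.castLE hmn (c.finWord (s + t)) := by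
    simpa [items] using hs 0
  refine hS a (h.mem_types (s := s) (l := u.length) (List.length_pos_of_ne_nil hu) ?_ ?_) ha
  · intro p hp t ht r hr
    have hlet : ∀ t < u.length, g ⟨p, hp⟩ (Fin.castLE hmn (c.finWord (s + t))) =
        Fin.castLE hmn (c.finWord (s + p * u.length + t)) := by
      have := (hitems ⟨p, hp⟩).symm.trans (hs ⟨p, hp⟩)
      nth_rw 1 [hu0] at this
      rw [List.map_map] at this
      exact fun t ht => List.map_inj_left.1 this t (List.mem_range.2 ht)
    have h1 := (hg ⟨p, hp⟩).eq_iff (a := Fin.castLE hmn (c.finWord (s + t)))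
      (b := Fin.castLE hmn (c.finWord (s + r)))
    rw [hlet t ht, hlet r (hr.trans ht)] at h1
    simpa [finWord, shift, Fin.ext_iff] using h1.symm
  · intro p q
    rw [← hmod p q, hs p, hs q, List.map_inj_left]
    simp [SameFactor, finWord, shift, Fin.ext_iff, add_assoc]

end Coding

/-! ### The codings -/

namespace Coding

open Parameter in
/-- Codings such that every set of at most four parameters misses the `types` of one of them. The
first list of `types` is `[α₁]`, and the others omit `α₁`. -/
def family : List Coding :=
  [⟨11, 52045302431, 52041534213, 0, 4, 9, [α₁]⟩,
    ⟨12, 112121121122, 112121122112, 2, 3, 7, [α₇, α₈, α₁₀, α₁₁, α₁₂]⟩,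
    ⟨20, 12131213231321231323, 12131213231213231213, 2, 7, 15, [α₃, α₄, α₁₁, α₁₄]⟩,
    ⟨14, 11123332111333, 11123332111222, 3, 2, 10, [α₂, α₅, α₆, α₉, α₁₀]⟩,
    ⟨13, 1122133211223, 1122133211332, 2, 3, 9, [α₂, α₅, α₁₀, α₁₂, α₁₃]⟩,
    ⟨13, 1112233311133, 1112233311122, 4, 2, 9, [α₆, α₉, α₁₀, α₁₂, α₁₃]⟩,
    ⟨21, 112112312112312112312, 112112312112112112312, 18, 10, 10, [α₂, α₄, α₇, α₈, α₁₂, α₁₄]⟩,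
    ⟨14, 11121112111213, 11121312111213, 13, 3, 8, [α₃, α₄, α₆, α₇, α₈, α₉]⟩,
    ⟨28, 1121131311211313323313323313, 1121131332331332323313323313, 24, 5, 18, [α₇, α₈, α₁₁, α₁₃]⟩,
    ⟨8, 11213122, 11213123, 0, 2, 5, [α₃, α₄, α₅, α₇, α₁₀, α₁₂, α₁₃, α₁₄]⟩,
    ⟨21, 111233321123321112332, 111233312213332112332, 3, 4, 13, [α₂, α₅, α₆, α₉, α₁₂]⟩,
    ⟨8, 11223123, 11232123, 0, 2, 6, [α₂, α₃, α₄, α₅, α₁₀, α₁₃, α₁₄]⟩]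

theorem valid_of_mem_family : ∀ c ∈ family, c.Valid := by
  decide +kernel

/-- All parameters, in order. -/
def allParameters : List Parameter :=
  [.α₁, .α₂, .α₃, .α₄, .α₅, .α₆, .α₇, .α₈, .α₉, .α₁₀, .α₁₁, .α₁₂, .α₁₃, .α₁₄]

theorem mem_allParameters (a : Parameter) : a ∈ allParameters := by
  cases a <;> decide

theorem exists_mem_family_of_three :
    ∀ a ∈ allParameters, ∀ b ∈ allParameters, ∀ d ∈ allParameters,
      ∃ c ∈ family, .α₁ ∉ c.types ∧ a ∉ c.types ∧ b ∉ c.types ∧ d ∉ c.types := by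
  decide +kernel

theorem exists_mem_family_avoiding (K : Finset Parameter) (hK : K.card ≤ 4) :
    ∃ c ∈ family, ∀ a ∈ c.types, a ∉ K := by
  by_cases h1 : .α₁ ∈ K
  · -- the other elements of `K` are among three parameters
    obtain ⟨a, b, d, hsub⟩ : ∃ a b d, ∀ x ∈ K.erase .α₁, x = a ∨ x = b ∨ x = d := by
      have hcard : (K.erase .α₁).toList.length ≤ 3 := by
        rw [Finset.length_toList, Finset.card_erase_of_mem h1]
        omega
      refine ⟨(K.erase .α₁).toList.getD 0 .α₁, (K.erase .α₁).toList.getD 1 .α₁,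
        (K.erase .α₁).toList.getD 2 .α₁, fun x hx => ?_⟩
      rw [← Finset.mem_toList] at hx
      obtain ⟨i, hi, rfl⟩ := List.mem_iff_getElem.1 hx
      rw [← List.getD_eq_getElem _ .α₁ hi]
      have : i < 3 := by omega
      interval_cases i <;> simp
    obtain ⟨c, hc, hc1, hca, hcb, hcd⟩ := exists_mem_family_of_three a (mem_allParameters a) b
      (mem_allParameters b) d (mem_allParameters d)
    refine ⟨c, hc, fun x hx hxK => ?_⟩
    have hx1 : x ≠ .α₁ := fun h => hc1 (h ▸ hx)
    rcases hsub x (Finset.mem_erase.2 ⟨hx1, hxK⟩) with rfl | rfl | rfl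
    exacts [hca hx, hcb hx, hcd hx]
  · exact ⟨_, List.mem_cons_self, by simpa using h1⟩

end Coding

theorem lemma1 (K' : Finset Parameter) (hK' : K'.card ≤ 4) :
    ∃ (m : ℕ) (w : ℕ → Fin m), FourPowerFree w ∧ AvoidsParameters w K' := by
  obtain ⟨c, hc, hcK⟩ := Coding.exists_mem_family_avoiding K' hK'
  have hv := Coding.valid_of_mem_family c hc
  exact ⟨10, c.finWord, hv.fourPowerFree, hv.avoidsParameters hcK⟩
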